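/- Let $n\ge 1$, let $\varepsilon_1,\dots,\varepsilon_n$ be the standard basis of $\mathbb R^n$, and let $S_n$ act on $\mathbb R^n$ by $w(\varepsilon_i)=\varepsilon_{w(i)}$. Let $\Delta_n^+=\{\varepsilon_i-\varepsilon_j \mid 1\le i<j\le n\}$ be the set of positive roots, with simple roots $\varepsilon_p-\varepsilon_{p+1}$, $1\le p\le n-1$, and identify $\mathbb R^{n-1}$ with the space of vectors in $\mathbb R^n$ whose coordinates sum to $0$, with natural basis $\varepsilon_p-\varepsilon_{p+1}$. For $w\in S_n$ let $\Phi(w)=\{\alpha\in\Delta_n^+ \mid -w(\alpha)\in\Delta_n^+\}$. Suppose that $w_1,w_2,w_3\in S_n$ satisfy $\Delta_n^+=\Phi(w_1)\sqcup\Phi(w_2)\sqcup\Phi(w_3)$ (disjoint union; some $\Phi(w_k)$ may be empty), and let $$S=\{\alpha\in\Delta_n^+ \mid -w_k(\alpha)\text{ is simple for some }k\in\{1,2,3\}\}.$$ Consider $3(n-1)$ variables $x_{k,p}$ with $k\in\{1,2,3\}$ and $1\le p\le n-1$. For $\alpha\in S$, the variable $x_{k,p}$ is called the $\alpha$-pivot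 variable if $-w_k(\alpha)=\varepsilon_p-\varepsilon_{p+1}$; it is called an $\alpha$-free variable if $w_k(\alpha)=\varepsilon_i-\varepsilon_j$ with $i<j$ and $i\le p<j$. (These are the variables on the left and on the right, respectively, of the equation $x_{k,p}=\sum_{l\ne k}\,(x_{l,i_l}+\dots+x_{l,j_l-1})$, where $-w_k(\alpha)=\varepsilon_p-\varepsilon_{p+1}$ and $w_l(\alpha)=\varepsilon_{i_l}-\varepsilon_{j_l}$ for $l\neq k$.) Then $S$ is a basis of $\mathbb R^{n-1}$. Furthermore, $S$ can be labeled $\{\alpha_1,\dots,\alpha_{n-1}\}$, with distinct $\alpha_i$, so that for all $i<j$ the $\alpha_i$-pivot variable is not an $\alpha_j$-free variable. -/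

import Mathlib

noncomputable section

namespace InversionDecomposition

/-- The vector `ε_i - ε_j` of `ℝ^n`. -/
def root {n : ℕ} (i j : Fin n) : Fin n → ℝ := Pi.single i 1 - Pi.single j 1

/-- The space `ℝ^(n-1)` in which the roots of type `A_(n-1)` live: the vectors of `ℝ^n` with
coordinate sum `0`. It has the simple roots `ε_p - ε_(p+1)` as its natural basis. -/
def rootSpace (n : ℕ) : Submodule ℝ (Fin n → ℝ) where
  carrier := {v | ∑ i, v i = 0}
  zero_mem' := by simp
  add_mem' := by
    intro a b ha hb
    change ∑ i, (a i + b i) = 0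
    rw [Finset.sum_add_distrib, show ∑ i, a i = 0 from ha, show ∑ i, b i = 0 from hb, add_zero]
  smul_mem' := by
    intro c a ha
    change ∑ i, c * a i = 0
    rw [← Finset.mul_sum, show ∑ i, a i = 0 from ha, mul_zero]

/-- The positive roots `ε_i - ε_j` with `i < j`. -/
def posRoots (n : ℕ) : Set (Fin n → ℝ) := {α | ∃ i j : Fin n, i < j ∧ α = root i j}

/-- The simple root `ε_p - ε_(p+1)`; the index `p` is counted from `0` to `n - 2`. -/
def simpleRoot {n : ℕ} (p : Fin (n - 1)) : Fin n → ℝ :=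
  root ⟨p.val, by omega⟩ ⟨p.val + 1, by omega⟩

/-- The action of the symmetric group on `ℝ^n` which permutes the standard basis:
`w (ε_i) = ε_(w i)`, so that `w (ε_i - ε_j) = ε_(w i) - ε_(w j)`. -/
def act {n : ℕ} (w : Equiv.Perm (Fin n)) (v : Fin n → ℝ) : Fin n → ℝ := fun i => v (w.symm i)

/-- The inversion set `Φ(w)`: the positive roots that `w` sends to negative roots. -/
def inversionSet {n : ℕ} (w : Equiv.Perm (Fin n)) : Set (Fin n → ℝ) :=
  {α | α ∈ posRoots n ∧ -act w α ∈ posRoots n}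

/-- The positive roots are the disjoint union of the inversion sets of `w 0`, `w 1`, `w 2`. -/
def IsDecomposition {n : ℕ} (w : Fin 3 → Equiv.Perm (Fin n)) : Prop :=
  posRoots n = (⋃ k, inversionSet (w k)) ∧
    Pairwise fun k l => Disjoint (inversionSet (w k)) (inversionSet (w l))

/-- The positive roots `α` such that `-w_k(α)` is simple for some `k`. -/
def basisSet {n : ℕ} (w : Fin 3 → Equiv.Perm (Fin n)) : Set (Fin n → ℝ) :=
  {α | α ∈ posRoots n ∧ ∃ k : Fin 3, ∃ p : Fin (n - 1), -act (w k) α = simpleRoot p}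

/-- The `3(n-1)` variables: `(0, p)`, `(1, p)`, `(2, p)` stand for
`a_p = λ_p - λ_(p+1)`, `b_p = μ_p - μ_(p+1)`, `c_p = ν_p - ν_(p+1)`. -/
abbrev Var (n : ℕ) : Type := Fin 3 × Fin (n - 1)

/-- The variable `x = (k, p)` is the `α`-pivot variable: `-w_k(α) = ε_p - ε_(p+1)`. -/
def IsPivot {n : ℕ} (w : Fin 3 → Equiv.Perm (Fin n)) (α : Fin n → ℝ) (x : Var n) : Prop :=
  -act (w x.1) α = simpleRoot x.2

/-- The variable `x = (k, p)` is an `α`-free variable: `w_k(α)` is a positive root `ε_i - ε_j`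
and `i ≤ p < j`, so that `x` is one of the variables with indices `i, …, j - 1`. -/
def IsFree {n : ℕ} (w : Fin 3 → Equiv.Perm (Fin n)) (α : Fin n → ℝ) (x : Var n) : Prop :=
  ∃ i j : Fin n, i < j ∧ act (w x.1) α = root i j ∧ i.val ≤ x.2.val ∧ x.2.val < j.val

end InversionDecomposition

end

/-! Colour each pair of indices by the one `w k` that inverts it. For `x < y < z` the pair `x z`
shares its colour with `x y` or `y z`, so no triangle is rainbow, and by Gallai's theorem
(`exists_not_joined`) some colour `d` is disconnected on any set of at least two indices. Inside a
block, the components of colour `d` are smaller blocks (`IsColoring.isBlock_component`), and indices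
in different components are ordered oppositely by the two permutations other than `w d`.

Rank a root by the smallest block containing its support. If the `α`-pivot is `β`-free, then `α` has
smaller rank than `β` (`IsColoring.blockRank_lt`), so listing the roots by decreasing rank gives the
labeling. The functional `prefixSum` of an `α`-pivot is `-1` at `α` and `0` at every other `β` for
which that pivot is not free; this triangularity gives independence. Spanning follows by induction
on blocks (`IsColoring.root_mem_span`). -/

namespace InversionDecomposition

open Relation

/-! ### Gallai's theorem on colourings without rainbow triangles -/

section Gallai

variable {V : Type*}

/-- `x` and `y` are joined by a path of colour `d` that stays in `s`. -/
def Joined (c : V → V → Fin 3) (s : Finset V) (d : Fin 3) : V → V → Prop :=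
  ReflTransGen fun a b => a ∈ s ∧ b ∈ s ∧ a ≠ b ∧ c a b = d

/-- No triangle carries three different colours. -/
def NoRainbow (c : V → V → Fin 3) : Prop :=
  ∀ x y z, x ≠ y → y ≠ z → x ≠ z → c x y = c x z ∨ c x y = c y z ∨ c x z = c y z

variable {c : V → V → Fin 3} {s : Finset V} {d : Fin 3} {x y z : V}

theorem Joined.symm (hs : ∀ x y, c x y = c y x) (h : Joined c s d x y) : Joined c s d y x := by
  induction h with
  | refl => exact .refl
  | tail _ hab ih => exact .head ⟨hab.2.1, hab.1, hab.2.2.1.symm, hs _ _ ▸ hab.2.2.2⟩ ih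

theorem Joined.mem (h : Joined c s d x y) (hx : x ∈ s) : y ∈ s := by
  induction h with
  | refl => exact hx
  | tail _ hab _ => exact hab.2.1

theorem Joined.of_color (hx : x ∈ s) (hy : y ∈ s) (hxy : x ≠ y) (hc : c x y = d) :
    Joined c s d x y := .single ⟨hx, hy, hxy, hc⟩

/-- The components of a colour are modules. -/
theorem Joined.color_eq (hr : NoRainbow c) (h : Joined c s d x y) (hz : z ∈ s)
    (hxz : ¬ Joined c s d x z) : c x z = c y z := by
  induction h with
  | refl => rfl
  | @tail a b ha hab ih =>
    obtain ⟨has, hbs, hne, hcol⟩ := hab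
    have hb : Joined c s d x b := .tail ha ⟨has, hbs, hne, hcol⟩
    have h1 : a ≠ z := by rintro rfl; exact hxz ha
    have h2 : b ≠ z := by rintro rfl; exact hxz hb
    have h3 : c a z ≠ d := fun h => hxz (.tail ha ⟨has, hz, h1, h⟩)
    have h4 : c b z ≠ d := fun h => hxz (.tail hb ⟨hbs, hz, h2, h⟩)
    rcases hr a b z hne h2 h1 with h | h | h
    · exact absurd (h ▸ hcol) h3
    · exact absurd (h ▸ hcol) h4
    · exact ih.trans h

/-- Cut the path at its first visit to `v`: what precedes stays in `s`. -/
theorem Joined.exists_of_insert [DecidableEq V] {v t : V} (hv : v ∉ s) (ht : t ∈ s)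
    (h : Joined c (insert v s) d t v) : ∃ u ∈ s, Joined c s d t u ∧ c u v = d := by
  have key : ∀ z, Joined c (insert v s) d t z →
      (z ∈ s ∧ Joined c s d t z) ∨ ∃ u ∈ s, Joined c s d t u ∧ c u v = d := by
    intro z hz
    induction hz with
    | refl => exact .inl ⟨ht, .refl⟩
    | @tail a b _ hab ih =>
      rcases ih with ⟨has, ha⟩ | h
      · obtain ⟨_, hb, hne, hcol⟩ := hab
        rcases Finset.mem_insert.1 hb with rfl | hb
        · exact .inr ⟨a, has, ha, hcol⟩
        · exact .inl ⟨hb, .tail ha ⟨has, hb, hne, hcol⟩⟩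
      · exact .inr h
  rcases key v h with h | h
  · exact absurd h.1 hv
  · exact h

/-- **Gallai's theorem** for three colours: if no triangle is rainbow, then some colour is
disconnected. -/
theorem exists_not_joined (hs : ∀ x y, c x y = c y x) (hr : NoRainbow c) (hcard : 2 ≤ s.card) :
    ∃ d, ∃ x ∈ s, ∃ y ∈ s, ¬ Joined c s d x y := by
  classical
  induction s using Finset.induction_on with
  | empty => simp at hcard
  | @insert v s hv ih =>
    by_contra! hcon
    have hne : s.Nonempty := by
      rw [Finset.nonempty_iff_ne_empty]; rintro rfl; simp at hcard
    have hedge : ∀ d, ∀ t ∈ s, ∃ u ∈ s, Joined c s d t u ∧ c u v = d := fun d t ht =>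
      (hcon d t (Finset.mem_insert_of_mem ht) v (Finset.mem_insert_self _ _)).exists_of_insert hv ht
    obtain ⟨t₀, ht₀⟩ := hne
    by_cases h2 : 2 ≤ s.card
    · obtain ⟨d, x, hx, y, hy, hxy⟩ := ih h2
      -- The `d`-component of `t` contains some `a` with `c a v = d`. In the triangle `u a v` the
      -- other two sides avoid `d`, hence agree, and `c u a = c u t` because components are modules.
      have hmono : ∀ u ∈ s, ∀ t ∈ s, c u v ≠ d → ¬ Joined c s d u t → c u t = c u v := by
        intro u hu t ht huv hut
        obtain ⟨a, ha, hta, hav⟩ := hedge d t ht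
        have hua : ¬ Joined c s d u a := fun h => hut (h.trans (hta.symm hs))
        have hne : u ≠ a := by rintro rfl; exact hua .refl
        have h1 : c u a ≠ d := fun h => hua (.of_color hu ha hne h)
        have h3 : c t u = c a u :=
          hta.color_eq hr hu fun h => hut (h.symm hs)
        rw [hs u t, h3, hs a u]
        rcases hr u a v hne (by rintro rfl; exact hv ha) (by rintro rfl; exact hv hu) with h | h | h
        · exact h
        · exact absurd (h.trans hav) h1
        · exact absurd (h.trans hav) huv
      -- Both colours other than `d` occur at `v`; `hmono` then forces one edge, or two edges of
      -- equal colour, to carry both.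
      obtain ⟨u, hu, -, huv⟩ := hedge (d + 1) t₀ ht₀
      obtain ⟨u', hu', -, huv'⟩ := hedge (d + 2) t₀ ht₀
      have hd1 : d + 1 ≠ d := by clear * -; revert d; decide
      have hd2 : d + 2 ≠ d := by clear * -; revert d; decide
      have hd12 : d + 1 ≠ d + 2 := by clear * -; revert d; decide
      by_cases huu : Joined c s d u u'
      · obtain ⟨t, ht, hut⟩ : ∃ t ∈ s, ¬ Joined c s d u t := by
          by_contra! hall
          exact hxy (((hall x hx).symm hs).trans (hall y hy))
        have h1 := hmono u hu t ht (huv ▸ hd1) hut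
        have h3 := hmono u' hu' t ht (huv' ▸ hd2) fun h => hut (huu.trans h)
        have h4 := huu.color_eq hr ht hut
        exact hd12 (by rw [← huv, ← huv', ← h1, ← h3, h4])
      · have h1 := hmono u hu u' hu' (huv ▸ hd1) huu
        have h3 := hmono u' hu' u hu (huv' ▸ hd2) fun h => huu (h.symm hs)
        exact hd12 (by rw [← huv, ← huv', ← h1, ← h3, hs])
    · obtain ⟨a, ha⟩ : ∃ a, s = {a} := by
        rw [← Finset.card_eq_one]
        have := Finset.card_pos.2 ⟨t₀, ht₀⟩
        omega
      subst ha
      obtain ⟨u, hu, -, huv⟩ := hedge 0 t₀ ht₀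
      obtain ⟨u', hu', -, huv'⟩ := hedge 1 t₀ ht₀
      rw [Finset.mem_singleton] at hu hu'
      subst hu hu'
      exact absurd (huv.symm.trans huv') (by decide)

end Gallai

/-! ### The colouring of pairs by the permutation that inverts them -/

variable {n : ℕ} {w : Fin 3 → Equiv.Perm (Fin n)} {c : Fin n → Fin n → Fin 3}

/-- `c` assigns to a pair of indices the unique permutation that inverts it. -/
def IsColoring (w : Fin 3 → Equiv.Perm (Fin n)) (c : Fin n → Fin n → Fin 3) : Prop :=
  (∀ x y, c x y = c y x) ∧ ∀ x y, x < y → ∀ k, w k y < w k x ↔ c x y = k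

theorem IsColoring.lt_iff_of_eq (hc : IsColoring w c) {x y : Fin n} {k : Fin 3} (hxy : x ≠ y)
    (h : c x y = k) : w k x < w k y ↔ y < x := by
  rcases lt_or_gt_of_ne hxy with hlt | hlt
  · have := (hc.2 x y hlt k).2 h
    exact iff_of_false this.not_gt hlt.not_gt
  · exact iff_of_true ((hc.2 y x hlt k).2 (hc.1 x y ▸ h)) hlt

theorem IsColoring.lt_iff_of_ne (hc : IsColoring w c) {x y : Fin n} {k : Fin 3}
    (h : c x y ≠ k) : w k x < w k y ↔ x < y := by
  rcases lt_trichotomy x y with hlt | rfl | hlt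
  · have := (hc.2 x y hlt k).not.2 h
    exact iff_of_true (lt_of_le_of_ne (not_lt.1 this) ((w k).injective.ne hlt.ne)) hlt
  · simp
  · have := (hc.2 y x hlt k).not.2 (hc.1 x y ▸ h)
    exact iff_of_false this hlt.not_gt

/-- Two permutations order the pairs oppositely that are not inverted by the third. -/
theorem IsColoring.lt_iff_gt (hc : IsColoring w c) {x y : Fin n} {d k l : Fin 3} (hxy : x ≠ y)
    (h : c x y ≠ d) (hkd : k ≠ d) (hld : l ≠ d) (hkl : k ≠ l) :
    w k x < w k y ↔ w l y < w l x := by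
  obtain h | h : c x y = k ∨ c x y = l := by
    generalize c x y = e at h; revert d k l e; decide
  · rw [hc.lt_iff_of_eq hxy h, hc.lt_iff_of_ne (hc.1 x y ▸ h ▸ hkl)]
  · rw [hc.lt_iff_of_eq hxy.symm (hc.1 x y ▸ h), hc.lt_iff_of_ne (h ▸ hkl.symm)]

/-- A permutation preserving the order of `x, y` and of `y, z` cannot invert `x, z`. -/
theorem IsColoring.eq_or_eq (hc : IsColoring w c) {x y z : Fin n} (hxy : x < y) (hyz : y < z) :
    c x z = c x y ∨ c x z = c y z := by
  by_contra! h
  have h1 := (hc.2 x z (hxy.trans hyz) _).2 rfl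
  have h2 := (hc.lt_iff_of_ne h.1.symm).2 hxy
  have h3 := (hc.lt_iff_of_ne h.2.symm).2 hyz
  exact (h1.trans (h2.trans h3)).false

theorem IsColoring.noRainbow (hc : IsColoring w c) : NoRainbow c := by
  intro x y z hxy hyz hxz
  have e := fun {x y z : Fin n} => hc.eq_or_eq (x := x) (y := y) (z := z)
  have s := hc.1
  rcases lt_or_gt_of_ne hxy with h1 | h1 <;> rcases lt_or_gt_of_ne hyz with h2 | h2 <;>
    rcases lt_or_gt_of_ne hxz with h3 | h3
  · have := e h1 h2; grind
  · exact absurd (h1.trans (h2.trans h3)) (lt_irrefl _)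
  · have := e h3 h2; grind
  · have := e h3 h1; grind
  · have := e h1 h3; grind
  · have := e h2 h3; grind
  · exact absurd (h1.trans (h3.trans h2)) (lt_irrefl _)
  · have := e h2 h1; grind

/-! ### Blocks and their decomposition into components -/

/-- A set of indices that is an interval in the natural order and in the orders defined by the
permutations: no index outside separates two of its elements. -/
def IsBlock (w : Fin 3 → Equiv.Perm (Fin n)) (M : Finset (Fin n)) : Prop :=
  ∀ z ∉ M, ∀ x ∈ M, ∀ y ∈ M, (z < x ↔ z < y) ∧ ∀ k, w k z < w k x ↔ w k z < w k y

theorem isBlock_univ (w : Fin 3 → Equiv.Perm (Fin n)) : IsBlock w Finset.univ :=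
  fun z hz => absurd (Finset.mem_univ z) hz

theorem IsBlock.mem_of_le_of_le {M : Finset (Fin n)} (hM : IsBlock w M) {x y z : Fin n}
    {k : Fin 3} (hx : x ∈ M) (hy : y ∈ M) (hxz : w k x ≤ w k z) (hzy : w k z ≤ w k y) : z ∈ M := by
  by_contra hz
  have hne : w k z ≠ w k y := fun h => hz ((w k).injective h ▸ hy)
  exact (((hM z hz x hx y hy).2 k).2 (lt_of_le_of_ne hzy hne)).not_ge hxz

open Classical in
/-- The component of `x` in the graph of colour `d` on `M`. -/
noncomputable def component (c : Fin n → Fin n → Fin 3) (M : Finset (Fin n)) (d : Fin 3) (x : Fin n) :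
    Finset (Fin n) := {z ∈ M | Joined c M d x z}

theorem mem_component {M : Finset (Fin n)} {d : Fin 3} {x z : Fin n} (hx : x ∈ M) :
    z ∈ component c M d x ↔ Joined c M d x z := by
  simp only [component, Finset.mem_filter, and_iff_right_iff_imp]
  exact fun h => h.mem hx

/-- If `z` separated the ends of a `d`-edge in the natural order, `eq_or_eq` would give it a
`d`-edge to one of them. The other orders follow, since `z` has the same colour to the whole
component. -/
theorem IsColoring.isBlock_component (hc : IsColoring w c) {M : Finset (Fin n)} (hM : IsBlock w M)
    {d : Fin 3} {x : Fin n} (hx : x ∈ M) : IsBlock w (component c M d x) := by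
  have key : ∀ z ∈ M, ¬ Joined c M d x z → ∀ a, Joined c M d x a →
      (z < x ↔ z < a) ∧ ∀ k, w k z < w k x ↔ w k z < w k a := by
    intro z hz hxz a ha
    have hlt : z < x ↔ z < a := by
      induction ha with
      | refl => rfl
      | @tail a b ha hab ih =>
        obtain ⟨has, hbs, hne, hcol⟩ := hab
        have hb : Joined c M d x b := .tail ha ⟨has, hbs, hne, hcol⟩
        have h1 : a ≠ z := by rintro rfl; exact hxz ha
        have h2 : b ≠ z := by rintro rfl; exact hxz hb
        have h3 : c a z ≠ d := fun h => hxz (.tail ha ⟨has, hz, h1, h⟩)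
        have h4 : c b z ≠ d := fun h => hxz (.tail hb ⟨hbs, hz, h2, h⟩)
        rw [ih]
        constructor <;> intro h
        · by_contra h'
          have := hc.eq_or_eq (lt_of_le_of_ne (not_lt.1 h') h2) h
          rw [hc.1 b a, hc.1 z a, hcol] at this
          exact this.elim (fun h => h4 h.symm) fun h => h3 h.symm
        · by_contra h'
          have := hc.eq_or_eq (lt_of_le_of_ne (not_lt.1 h') h1) h
          rw [hc.1 z b, hcol] at this
          exact this.elim (fun h => h3 h.symm) fun h => h4 h.symm
    refine ⟨hlt, fun k => ?_⟩
    have hcol : c z x = c z a := by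
      rw [hc.1 z x, hc.1 z a]; exact ha.color_eq hc.noRainbow hz hxz
    have hzx : z ≠ x := by rintro rfl; exact hxz .refl
    have hza : z ≠ a := by rintro rfl; exact hxz ha
    by_cases h : c z x = k
    · rw [hc.lt_iff_of_eq hzx h, hc.lt_iff_of_eq hza (hcol ▸ h)]
      have h1 : x < z ↔ ¬ z < x := by rw [not_lt, hzx.symm.le_iff_lt]
      have h2 : a < z ↔ ¬ z < a := by rw [not_lt, hza.symm.le_iff_lt]
      rw [h1, h2, hlt]
    · rw [hc.lt_iff_of_ne h, hc.lt_iff_of_ne (hcol ▸ h), hlt]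
  intro z hz a ha b hb
  rw [mem_component hx] at hz ha hb
  by_cases hzM : z ∈ M
  · have h1 := key z hzM hz a ha
    have h2 := key z hzM hz b hb
    exact ⟨h1.1.symm.trans h2.1, fun k => (h1.2 k).symm.trans (h2.2 k)⟩
  · exact hM z hzM a (ha.mem hx) b (hb.mem hx)

/-- A block with at least two elements has a colour all of whose components are smaller. -/
theorem IsColoring.exists_component_card_lt (hc : IsColoring w c) {M : Finset (Fin n)}
    (h : 2 ≤ M.card) : ∃ d, ∀ x ∈ M, (component c M d x).card < M.card := by
  obtain ⟨d, a, ha, b, hb, hab⟩ := exists_not_joined hc.1 hc.noRainbow h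
  refine ⟨d, fun x hx => Finset.card_lt_card ?_⟩
  refine ⟨fun z hz => ((mem_component hx).1 hz).mem hx, fun hsub => hab ?_⟩
  exact (((mem_component hx).1 (hsub ha)).symm hc.1).trans ((mem_component hx).1 (hsub hb))

theorem IsColoring.color_eq_of_adjacent (hc : IsColoring w c) {x y : Fin n} {k : Fin 3}
    (hxy : x < y) (h : (w k x).val = (w k y).val + 1) : c x y = k :=
  (hc.2 x y hxy k).1 (Fin.lt_def.2 (by omega))

/-- If the pivot of the pair `(x, y)` is free for the pair `(u, v)`, then a block containing
all of these indices has a smaller block that contains one of the pairs. -/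
theorem IsColoring.exists_smaller_block (hc : IsColoring w c) {N : Finset (Fin n)}
    (hN : IsBlock w N) {x y u v : Fin n} {k l : Fin 3} (hx : x ∈ N) (hy : y ∈ N) (hu : u ∈ N)
    (hv : v ∈ N) (hxy : x < y) (huv : u < v) (hk : (w k x).val = (w k y).val + 1)
    (hl : (w l u).val = (w l v).val + 1) (huy : w k u ≤ w k y) (hxv : w k x ≤ w k v) :
    ∃ J, IsBlock w J ∧ J.card < N.card ∧ (x ∈ J ∧ y ∈ J ∨ u ∈ J ∧ v ∈ J) := by
  have hcxy : c x y = k := hc.color_eq_of_adjacent hxy hk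
  have hcuv : c u v = l := hc.color_eq_of_adjacent huv hl
  have hyx : w k y < w k x := Fin.lt_def.2 (by omega)
  obtain ⟨d, hd⟩ := hc.exists_component_card_lt (Finset.one_lt_card.2 ⟨x, hx, y, hy, hxy.ne⟩)
  by_contra! hcon
  have hnot : ∀ a ∈ N, ¬ (Joined c N d a x ∧ Joined c N d a y) ∧
      ¬ (Joined c N d a u ∧ Joined c N d a v) := by
    intro a ha
    have := hcon _ (hc.isBlock_component hN (d := d) ha) (hd a ha)
    simp only [mem_component ha] at this
    exact ⟨fun h => this.1 h.1 h.2, fun h => this.2 h.1 h.2⟩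
  have hJxy : ¬ Joined c N d x y := fun h => (hnot x hx).1 ⟨.refl, h⟩
  have hJuv : ¬ Joined c N d u v := fun h => (hnot u hu).2 ⟨.refl, h⟩
  have hkd : k ≠ d := fun h => hJxy (.of_color hx hy hxy.ne (hcxy.trans h))
  have hld : l ≠ d := fun h => hJuv (.of_color hu hv huv.ne (hcuv.trans h))
  have hkl : k ≠ l := by
    rintro rfl
    have := Fin.le_def.1 huy; have := Fin.le_def.1 hxv
    omega
  -- Otherwise `z` lies strictly between `u` and `v` for `w k`, hence also for the opposite order `w
  -- l`, where `u` and `v` are adjacent.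
  have hmem : ∀ z ∈ N, w k u ≤ w k z → w k z ≤ w k v → Joined c N d u z ∨ Joined c N d v z := by
    intro z hz huz hzv
    by_contra! h
    have hzu : u ≠ z := by rintro rfl; exact h.1 .refl
    have hvz : z ≠ v := by rintro rfl; exact h.2 .refl
    have h1 : c u z ≠ d := fun h' => h.1 (.of_color hu hz hzu h')
    have h2 : c z v ≠ d := fun h' => h.2 (.of_color hv hz hvz.symm (hc.1 z v ▸ h'))
    have h3 := (hc.lt_iff_gt hzu h1 hkd hld hkl).1
      (lt_of_le_of_ne huz ((w k).injective.ne hzu))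
    have h4 := (hc.lt_iff_gt hvz h2 hkd hld hkl).1
      (lt_of_le_of_ne hzv ((w k).injective.ne hvz))
    rw [Fin.lt_def] at h3 h4
    omega
  -- All edges between two components have one colour, here `l`. So `x` and `y`, whose colour is
  -- `k`, cannot lie in different ones.
  have hmod : ∀ a b, Joined c N d u a → Joined c N d v b → c a b = l := by
    intro a b ha hb
    have h1 := ha.color_eq hc.noRainbow hv hJuv
    have h2 := hb.color_eq hc.noRainbow (ha.mem hu)
      fun h => hJuv (ha.trans (h.symm hc.1))
    rw [hc.1 a b, ← h2, hc.1 v a, ← h1, hcuv]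
  rcases hmem x hx (huy.trans hyx.le) hxv with h1 | h1 <;>
    rcases hmem y hy huy (hyx.le.trans hxv) with h2 | h2
  · exact (hnot u hu).1 ⟨h1, h2⟩
  · exact hkl (hcxy.symm.trans (hmod x y h1 h2))
  · exact hkl (hcxy.symm.trans (hc.1 x y ▸ hmod y x h2 h1))
  · exact (hnot v hv).1 ⟨h1, h2⟩

/-! ### The rank of a root -/

/-- The size of the smallest block that contains the support of `α`. -/
noncomputable def blockRank (w : Fin 3 → Equiv.Perm (Fin n)) (α : Fin n → ℝ) : ℕ :=
  sInf {m | ∃ M, IsBlock w M ∧ (∀ i, α i ≠ 0 → i ∈ M) ∧ M.card = m}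

theorem exists_block_card_eq_blockRank (w : Fin 3 → Equiv.Perm (Fin n)) (α : Fin n → ℝ) :
    ∃ M, IsBlock w M ∧ (∀ i, α i ≠ 0 → i ∈ M) ∧ M.card = blockRank w α :=
  Nat.sInf_mem (s := {m | ∃ M, IsBlock w M ∧ (∀ i, α i ≠ 0 → i ∈ M) ∧ M.card = m})
    ⟨_, Finset.univ, isBlock_univ w, fun i _ => Finset.mem_univ i, rfl⟩

theorem blockRank_le {α : Fin n → ℝ} {M : Finset (Fin n)} (hM : IsBlock w M)
    (h : ∀ i, α i ≠ 0 → i ∈ M) : blockRank w α ≤ M.card :=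
  Nat.sInf_le ⟨M, hM, h, rfl⟩

theorem root_apply_ne_zero_iff {i j m : Fin n} (hij : i ≠ j) :
    root i j m ≠ 0 ↔ m = i ∨ m = j := by
  by_cases h1 : m = i <;> by_cases h2 : m = j <;>
    simp_all [root]

/-- A smallest block containing `u, v` is an interval for `w k`, so it contains `x, y`. By
minimality the smaller block found inside cannot contain `u, v`, so it contains `x, y`. -/
theorem IsColoring.blockRank_lt (hc : IsColoring w c) {x y u v : Fin n} {k l : Fin 3}
    (hxy : x < y) (huv : u < v) (hk : (w k x).val = (w k y).val + 1)
    (hl : (w l u).val = (w l v).val + 1) (huy : w k u ≤ w k y) (hxv : w k x ≤ w k v) :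
    blockRank w (root x y) < blockRank w (root u v) := by
  obtain ⟨N, hN, hsub, hcard⟩ := exists_block_card_eq_blockRank w (root u v)
  have hu : u ∈ N := hsub u ((root_apply_ne_zero_iff huv.ne).2 (.inl rfl))
  have hv : v ∈ N := hsub v ((root_apply_ne_zero_iff huv.ne).2 (.inr rfl))
  have hyx : w k y ≤ w k x := Fin.le_def.2 (by omega)
  have hx : x ∈ N := hN.mem_of_le_of_le hu hv (huy.trans hyx) hxv
  have hy : y ∈ N := hN.mem_of_le_of_le hu hv huy (hyx.trans hxv)
  have hle : ∀ (a b : Fin n) (J : Finset (Fin n)), a < b → IsBlock w J → a ∈ J → b ∈ J →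
      blockRank w (root a b) ≤ J.card := by
    intro a b J hab hJ ha hb
    refine blockRank_le hJ fun i hi => ?_
    rcases (root_apply_ne_zero_iff hab.ne).1 hi with rfl | rfl <;> assumption
  obtain ⟨J, hJ, hlt, hJ'⟩ := hc.exists_smaller_block hN hx hy hu hv hxy huv hk hl huy hxv
  rcases hJ' with ⟨h1, h2⟩ | ⟨h1, h2⟩
  · exact (hle x y J hxy hJ h1 h2).trans_lt (hlt.trans_eq hcard)
  · exact absurd ((hle u v J huv hJ h1 h2).trans_lt hlt) (by rw [hcard]; exact lt_irrefl _)

/-! ### Translation between roots and pairs of indices -/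

theorem act_root (v : Equiv.Perm (Fin n)) (i j : Fin n) : act v (root i j) = root (v i) (v j) := by
  ext m
  simp [act, root, Pi.single_apply, Equiv.symm_apply_eq]

theorem neg_root (i j : Fin n) : -root i j = root j i := by simp [root]

theorem root_self (i : Fin n) : root i i = 0 := by simp [root]

theorem root_add_root (i j k : Fin n) : root i j + root j k = root i k := by simp [root]

theorem root_inj {i j i' j' : Fin n} (hij : i ≠ j) (h : root i j = root i' j') :
    i = i' ∧ j = j' := by
  have h1 := congrFun h i
  have h2 := congrFun h j
  simp only [root, Pi.sub_apply, Pi.single_apply] at h1 h2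
  rw [if_pos trivial, if_neg hij] at h1
  rw [if_neg hij.symm, if_pos trivial] at h2
  constructor
  · by_contra hne
    rw [if_neg hne] at h1
    split_ifs at h1 <;> norm_num at h1
  · by_contra hne
    rw [if_neg hne] at h2
    split_ifs at h2 <;> norm_num at h2

theorem root_mem_posRoots_iff {i j : Fin n} (hij : i ≠ j) : root i j ∈ posRoots n ↔ i < j := by
  constructor
  · rintro ⟨a, b, hab, h⟩
    obtain ⟨rfl, rfl⟩ := root_inj hij h
    exact hab
  · exact fun h => ⟨i, j, h, rfl⟩

theorem mem_basisSet_iff {α : Fin n → ℝ} : α ∈ basisSet w ↔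
    ∃ x y k, x < y ∧ (w k x).val = (w k y).val + 1 ∧ α = root x y := by
  constructor
  · rintro ⟨⟨x, y, hxy, rfl⟩, k, p, h⟩
    rw [act_root, neg_root] at h
    obtain ⟨h1, h2⟩ := root_inj ((w k).injective.ne hxy.ne') h
    exact ⟨x, y, k, hxy, by rw [h1, h2], rfl⟩
  · rintro ⟨x, y, k, hxy, hk, rfl⟩
    refine ⟨⟨x, y, hxy, rfl⟩, k, ⟨(w k y).val, by omega⟩, ?_⟩
    rw [act_root, neg_root, simpleRoot]
    congr 1
    exact Fin.ext hk

theorem mem_inversionSet_iff {x y : Fin n} (hxy : x < y) (k : Fin 3) :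
    root x y ∈ inversionSet (w k) ↔ w k y < w k x := by
  have : -act (w k) (root x y) ∈ posRoots n ↔ w k y < w k x := by
    rw [act_root, neg_root, root_mem_posRoots_iff ((w k).injective.ne hxy.ne')]
  exact ⟨fun h => this.1 h.2, fun h => ⟨⟨x, y, hxy, rfl⟩, this.2 h⟩⟩

theorem IsDecomposition.exists_isColoring (hw : IsDecomposition w) : ∃ c, IsColoring w c := by
  have hex : ∀ x y : Fin n, ∃ k, x < y → w k y < w k x := by
    intro x y
    by_cases hxy : x < y
    · have : root x y ∈ ⋃ k, inversionSet (w k) := hw.1 ▸ ⟨x, y, hxy, rfl⟩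
      obtain ⟨k, hk⟩ := Set.mem_iUnion.1 this
      exact ⟨k, fun _ => (mem_inversionSet_iff hxy k).1 hk⟩
    -- Arbitrary: only the diagonal colours ever use this value.
    · exact ⟨0, fun h => absurd h hxy⟩
  choose f hf using hex
  refine ⟨fun x y => f (min x y) (max x y), fun x y => ?_, ?_⟩
  · simp only [min_comm, max_comm]
  intro x y hxy k
  simp only [min_eq_left hxy.le, max_eq_right hxy.le]
  refine ⟨fun h => ?_, fun h => h ▸ hf x y hxy⟩
  by_contra hne
  exact Set.disjoint_left.1 (hw.2 hne) ((mem_inversionSet_iff hxy _).2 (hf x y hxy))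
    ((mem_inversionSet_iff hxy _).2 h)

theorem IsColoring.blockRank_lt_of_isPivot_of_isFree (hc : IsColoring w c) {α β : Fin n → ℝ}
    (hα : α ∈ basisSet w) (hβ : β ∈ basisSet w) {x : Var n} (hp : IsPivot w α x)
    (hf : IsFree w β x) : blockRank w α < blockRank w β := by
  obtain ⟨⟨a, b, hab, rfl⟩, -⟩ := hα
  obtain ⟨u, v, l, huv, hl, rfl⟩ := mem_basisSet_iff.1 hβ
  obtain ⟨i, j, hij, hf, hi, hj⟩ := hf
  rw [IsPivot, act_root, neg_root] at hp
  rw [act_root] at hf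
  obtain ⟨h1, h2⟩ := root_inj ((w x.1).injective.ne hab.ne') hp
  obtain ⟨h3, h4⟩ := root_inj ((w x.1).injective.ne huv.ne) hf
  have h1 := congrArg Fin.val h1
  have h2 := congrArg Fin.val h2
  refine hc.blockRank_lt hab huv (k := x.1) (by simp only [h1, h2]) hl ?_ ?_
  · rw [Fin.le_def, h1, h3]; exact hi
  · rw [Fin.le_def, h2, h4]; exact hj

/-! ### Linear independence -/

/-- The functional that sums the coordinates of `v` which `w k` sends to at most `p`. -/
def prefixSum (w : Fin 3 → Equiv.Perm (Fin n)) (x : Var n) : (Fin n → ℝ) →ₗ[ℝ] ℝ :=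
  ∑ i with (w x.1 i).val ≤ x.2.val, LinearMap.proj i

theorem prefixSum_root (x : Var n) (i j : Fin n) : prefixSum w x (root i j) =
    (if (w x.1 i).val ≤ x.2.val then 1 else 0) - if (w x.1 j).val ≤ x.2.val then 1 else 0 := by
  simp [prefixSum, root, Pi.single_apply, Finset.sum_sub_distrib]

theorem prefixSum_eq_neg_one {α : Fin n → ℝ} (hα : α ∈ basisSet w) {x : Var n}
    (hp : IsPivot w α x) : prefixSum w x α = -1 := by
  obtain ⟨⟨a, b, hab, rfl⟩, -⟩ := hα
  rw [IsPivot, act_root, neg_root] at hp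
  obtain ⟨h1, h2⟩ := root_inj ((w x.1).injective.ne hab.ne') hp
  rw [prefixSum_root, h1, h2]
  simp

/-- If `w x.1` inverts `β`, then `-w x.1 (β)` is itself simple, and it crosses the cut at `x.2` only
when `β = α`. If not, crossing the cut means being free. -/
theorem IsColoring.prefixSum_eq_zero (hc : IsColoring w c) {α β : Fin n → ℝ}
    (hα : α ∈ basisSet w) (hβ : β ∈ basisSet w) (hne : α ≠ β) {x : Var n} (hp : IsPivot w α x)
    (hf : ¬ IsFree w β x) : prefixSum w x β = 0 := by
  obtain ⟨⟨a, b, hab, rfl⟩, -⟩ := hα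
  obtain ⟨u, v, l, huv, hl, rfl⟩ := mem_basisSet_iff.1 hβ
  rw [IsPivot, act_root, neg_root] at hp
  obtain ⟨h1, h2⟩ := root_inj ((w x.1).injective.ne hab.ne') hp
  rw [prefixSum_root]
  by_cases hlt : w x.1 u < w x.1 v
  · have : ¬ ((w x.1 u).val ≤ x.2.val ∧ x.2.val < (w x.1 v).val) := fun h =>
      hf ⟨_, _, hlt, act_root _ _ _, h.1, h.2⟩
    rw [Fin.lt_def] at hlt
    split_ifs <;> first | omega | simp
  · have hvu : w x.1 v < w x.1 u :=
      lt_of_le_of_ne (not_lt.1 hlt) ((w x.1).injective.ne huv.ne')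
    have hlx : l = x.1 :=
      (hc.color_eq_of_adjacent huv hl).symm.trans ((hc.2 u v huv x.1).1 hvu)
    subst hlx
    have : (w x.1 v).val ≠ x.2.val := by
      intro h
      have hb : b = v := (w x.1).injective (Fin.ext (by rw [h1, h]))
      have ha : a = u := (w x.1).injective (Fin.ext (by rw [h2, hl, h]))
      exact hne (by rw [ha, hb])
    split_ifs <;> first | omega | simp

theorem IsColoring.linearIndepOn_basisSet (hc : IsColoring w c) :
    LinearIndepOn ℝ id (basisSet w) := by
  rw [LinearIndepOn, linearIndependent_iff']
  intro s g hg
  by_contra! hcon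
  obtain ⟨a, ha, hga⟩ := hcon
  -- With maximal rank, every `b` for which the pivot of `a` is free has coefficient `0`.
  obtain ⟨a, ha, hmax⟩ := Finset.exists_max_image {b ∈ s | g b ≠ 0}
    (fun b => blockRank w b.1) ⟨a, Finset.mem_filter.2 ⟨ha, hga⟩⟩
  rw [Finset.mem_filter] at ha
  obtain ⟨k, p, hp⟩ := a.2.2
  have hp : IsPivot w a.1 (k, p) := hp
  have h := congrArg (prefixSum w (k, p)) hg
  rw [map_sum, map_zero, Finset.sum_eq_single_of_mem a ha.1] at h
  · rw [map_smul, id, prefixSum_eq_neg_one a.2 hp] at h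
    exact ha.2 (by simpa using h)
  · intro b hb hba
    rw [map_smul, id]
    by_cases hgb : g b = 0
    · rw [hgb, zero_smul]
    · rw [hc.prefixSum_eq_zero a.2 b.2 (fun h => hba (Subtype.ext h.symm)) hp, smul_zero]
      intro hf
      exact (hmax b (Finset.mem_filter.2 ⟨hb, hgb⟩)).not_gt
        (hc.blockRank_lt_of_isPivot_of_isFree a.2 b.2 hp hf)

/-! ### Spanning -/

/-- Two adjacent indices that lie in different components of colour `d` are connected by an
element of the basis, up to differences inside the components. -/
theorem IsColoring.exists_adjacent_of_adjacent (hc : IsColoring w c) {M : Finset (Fin n)}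
    (hM : IsBlock w M) {x y : Fin n} {d k l : Fin 3} (hx : x ∈ M) (hy : y ∈ M) (hxy : x < y)
    (hJ : ¬ Joined c M d x y) (hcol : c x y = k) (hld : l ≠ d) (hkl : k ≠ l)
    (hl : (w l y).val = (w l x).val + 1) : ∃ x' y', Joined c M d x x' ∧ Joined c M d y y' ∧
      x' < y' ∧ (w k x').val = (w k y').val + 1 := by
  have hkd : k ≠ d := fun h => hJ (.of_color hx hy hxy.ne (hcol.trans h))
  have hBx := hc.isBlock_component hM (d := d) hx
  have hBy := hc.isBlock_component hM (d := d) hy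
  -- These extremes face each other for `w k`. An index between them would lie outside both
  -- components, hence between `x` and `y` for `w k` and so for `w l`, where they are adjacent.
  obtain ⟨x', hx', hmin⟩ := Finset.exists_min_image (component c M d x) (w k)
    ⟨x, (mem_component hx).2 .refl⟩
  obtain ⟨y', hy', hmax⟩ := Finset.exists_max_image (component c M d y) (w k)
    ⟨y, (mem_component hy).2 .refl⟩
  have hxx : x ∈ component c M d x := (mem_component hx).2 .refl
  have hyy : y ∈ component c M d y := (mem_component hy).2 .refl
  have hdisj : ∀ z ∈ component c M d y, z ∉ component c M d x := fun z hz hz' =>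
    hJ (((mem_component hx).1 hz').trans (((mem_component hy).1 hz).symm hc.1))
  have hdisj' : ∀ z ∈ component c M d x, z ∉ component c M d y := fun z hz hz' => hdisj z hz' hz
  have h1 : w k y < w k x := (hc.2 x y hxy k).2 hcol
  have h2 : w k y < w k x' := ((hBx y (hdisj y hyy) x hxx x' hx').2 k).1 h1
  have h3 : w k y' < w k x' := by
    have := (hBy x' (hdisj' x' hx') y hyy y' hy').2 k
    exact lt_of_le_of_ne (not_lt.1 (this.not.1 h2.not_gt))
      ((w k).injective.ne fun h => hdisj y' hy' (h ▸ hx'))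
  refine ⟨x', y', (mem_component hx).1 hx', (mem_component hy).1 hy', ?_, ?_⟩
  · have h4 : x < y' := by
      have := (hBy x (hdisj' x hxx) y hyy y' hy').1.1 hxy
      exact this
    have := (hBx y' (hdisj y' hy') x hxx x' hx').1
    exact lt_of_le_of_ne (not_lt.1 (this.not.1 h4.not_gt)) fun h => hdisj y' hy' (h ▸ hx')
  · by_contra hne
    obtain ⟨z, hz⟩ := (w k).surjective ⟨(w k y').val + 1, by omega⟩
    have hzv := congrArg Fin.val hz
    simp only at hzv
    rw [Fin.lt_def] at h3
    have hyz : w k y' < w k z := Fin.lt_def.2 (by omega)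
    have hzx : w k z < w k x' := Fin.lt_def.2 (by omega)
    have hzM : z ∈ M := hM.mem_of_le_of_le (((mem_component hy).1 hy').mem hy)
      (((mem_component hx).1 hx').mem hx) hyz.le hzx.le
    have hzx' : z ∉ component c M d x := fun h => (hmin z h).not_gt hzx
    have hzy' : z ∉ component c M d y := fun h => (hmax z h).not_gt hyz
    have h5 : w k z < w k x := ((hBx z hzx' x' hx' x hxx).2 k).1 hzx
    have h6 : w k y < w k z := by
      have := (hBy z hzy' y' hy' y hyy).2 k
      exact lt_of_le_of_ne (not_lt.1 (this.not.1 hyz.not_gt))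
        ((w k).injective.ne fun h => hzy' (h ▸ hyy))
    rw [mem_component hx] at hzx'
    rw [mem_component hy] at hzy'
    have hzxne : z ≠ x := by rintro rfl; exact hzx' .refl
    have hzyne : y ≠ z := by rintro rfl; exact hzy' .refl
    have h7 := (hc.lt_iff_gt hzxne
      (fun h => hzx' (.of_color hx hzM hzxne.symm (hc.1 z x ▸ h))) hkd hld hkl).1 h5
    have h8 := (hc.lt_iff_gt hzyne (fun h => hzy' (.of_color hy hzM hzyne h)) hkd hld hkl).1 h6
    rw [Fin.lt_def] at h7 h8
    omega

/-- Induction handles differences within a component. For a fixed `l ≠ d` the block is an interval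
of `w l`, so it suffices to treat neighbours for `w l`: their difference is a basis root up to sign,
or one corrected inside two components. -/
theorem IsColoring.root_mem_span (hc : IsColoring w c) (M : Finset (Fin n)) (hM : IsBlock w M) :
    ∀ x ∈ M, ∀ y ∈ M, root x y ∈ Submodule.span ℝ (basisSet w) := by
  induction hcard : M.card using Nat.strong_induction_on generalizing M with
  | _ m ih =>
  subst hcard
  set W := Submodule.span ℝ (basisSet w)
  have hswap : ∀ {a b}, root a b ∈ W → root b a ∈ W := fun {a b} h => by
    rw [← neg_root]; exact W.neg_mem h
  have htrans : ∀ {a b e}, root a b ∈ W → root b e ∈ W → root a e ∈ W := fun {a b e} h h' => by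
    rw [← root_add_root a b e]; exact W.add_mem h h'
  by_cases h2 : 2 ≤ M.card
  swap
  · intro x hx y hy
    rw [Finset.card_le_one.1 (by omega) x hx y hy, root_self]
    exact W.zero_mem
  obtain ⟨d, hd⟩ := hc.exists_component_card_lt h2
  have hjoin : ∀ {a b}, a ∈ M → Joined c M d a b → root a b ∈ W := fun {a b} ha hab =>
    ih _ (hd a ha) _ (hc.isBlock_component hM ha) rfl a ((mem_component ha).2 .refl) b
      ((mem_component ha).2 hab)
  obtain ⟨l, hl⟩ : ∃ l, l ≠ d := exists_ne d
  have hadj : ∀ x ∈ M, ∀ y ∈ M, (w l y).val = (w l x).val + 1 → root x y ∈ W := by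
    intro x hx y hy hxy
    by_cases hJ : Joined c M d x y
    · exact hjoin hx hJ
    have hne : x ≠ y := by rintro rfl; exact hJ .refl
    have hlt : w l x < w l y := Fin.lt_def.2 (by omega)
    by_cases hcl : c x y = l
    · have hyx : y < x := (hc.lt_iff_of_eq hne hcl).1 hlt
      exact hswap (Submodule.subset_span (mem_basisSet_iff.2 ⟨y, x, l, hyx, hxy, rfl⟩))
    · obtain ⟨x', y', h1, h2, h3, h4⟩ := hc.exists_adjacent_of_adjacent hM hx hy
        ((hc.lt_iff_of_ne hcl).1 hlt) hJ rfl hl hcl hxy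
      have h5 : root x' y' ∈ W :=
        Submodule.subset_span (mem_basisSet_iff.2 ⟨x', y', _, h3, h4, rfl⟩)
      exact htrans (hjoin hx h1) (htrans h5 (hswap (hjoin hy h2)))
  have hgap : ∀ g : ℕ, ∀ x ∈ M, ∀ y ∈ M, (w l y).val = (w l x).val + g → root x y ∈ W := by
    intro g
    induction g with
    | zero =>
      intro x hx y hy h
      rw [(w l).injective (Fin.ext h.symm : w l x = w l y), root_self]
      exact W.zero_mem
    | succ g ihg =>
      intro x hx y hy h
      obtain ⟨z, hz⟩ := (w l).surjective ⟨(w l x).val + g, by omega⟩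
      have hzv := congrArg Fin.val hz
      simp only at hzv
      have hzM : z ∈ M := hM.mem_of_le_of_le (k := l) hx hy (Fin.le_def.2 (by omega))
        (Fin.le_def.2 (by omega))
      exact htrans (ihg x hx z hzM hzv) (hadj z hzM y hy (by omega))
  intro x hx y hy
  rcases le_total (w l x).val (w l y).val with h | h
  · exact hgap _ x hx y hy (Nat.add_sub_of_le h).symm
  · exact hswap (hgap _ y hy x hx (Nat.add_sub_of_le h).symm)

theorem root_mem_rootSpace (i j : Fin n) : root i j ∈ rootSpace n := by
  change ∑ m, root i j m = 0
  simp [root]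

theorem IsColoring.span_basisSet (hc : IsColoring w c) (hn : 1 ≤ n) :
    Submodule.span ℝ (basisSet w) = rootSpace n := by
  refine le_antisymm (Submodule.span_le.2 ?_) fun v hv => ?_
  · rintro α ⟨⟨i, j, -, rfl⟩, -⟩
    exact root_mem_rootSpace i j
  · have hv : ∑ i, v i = 0 := hv
    let o : Fin n := ⟨0, hn⟩
    have : v = ∑ i, v i • root i o := by
      simp only [root, smul_sub, Finset.sum_sub_distrib, ← Finset.sum_smul, hv, zero_smul, sub_zero]
      ext j
      simp [Pi.single_apply]
    rw [this]
    exact Submodule.sum_mem _ fun i _ => Submodule.smul_mem _ _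
      (hc.root_mem_span _ (isBlock_univ w) i (Finset.mem_univ i) o (Finset.mem_univ o))

/-! ### Dimension count and labeling by decreasing rank -/

theorem finrank_rootSpace (hn : 1 ≤ n) : Module.finrank ℝ (rootSpace n) = n - 1 := by
  let f : Module.Dual ℝ (Fin n → ℝ) := ∑ i, LinearMap.proj i
  have hf : f ≠ 0 := fun h => by
    have := LinearMap.congr_fun h (Pi.single ⟨0, hn⟩ 1)
    simp [f] at this
  have hker : rootSpace n = f.ker := by
    ext v
    change ∑ i, v i = 0 ↔ _
    simp [f]
  have := Module.Dual.finrank_ker_add_one_of_ne_zero hf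
  rw [← hker, Module.finrank_fin_fun] at this
  omega

theorem IsColoring.exists_enumeration (hc : IsColoring w c) (hn : 1 ≤ n) :
    ∃ α : Fin (n - 1) → (Fin n → ℝ), Function.Injective α ∧ Set.range α = basisSet w ∧
      ∀ i j, i < j → blockRank w (α j) ≤ blockRank w (α i) := by
  have hli := hc.linearIndepOn_basisSet
  have hfin : (basisSet w).Finite := hli.setFinite
  have := hfin.fintype
  have hcard : Fintype.card (basisSet w) = n - 1 := by
    rw [← finrank_rootSpace hn, ← hc.span_basisSet hn, ← Set.toFinset_card]
    exact (finrank_span_set_eq_card hli).symm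
  let e := (Fintype.equivFinOfCardEq hcard).symm
  -- The order dual makes the sort decreasing in rank.
  let f : Fin (n - 1) → ℕᵒᵈ := fun i => OrderDual.toDual (blockRank w (e i).1)
  refine ⟨fun i => (e (Tuple.sort f i)).1, Subtype.val_injective.comp
    (e.injective.comp (Tuple.sort f).injective), ?_, fun i j hij => ?_⟩
  · have := ((Tuple.sort f).trans e).surjective.range_comp (Subtype.val : basisSet w → Fin n → ℝ)
    rw [Subtype.range_val] at this
    exact this
  · exact Tuple.monotone_sort f hij.le

end InversionDecomposition

open InversionDecomposition in
theorem mainTheorem7 (n : ℕ) (hn : 1 ≤ n) (w : Fin 3 → Equiv.Perm (Fin n))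
    (hw : InversionDecomposition.IsDecomposition w) :
    (LinearIndepOn ℝ id (InversionDecomposition.basisSet w) ∧
      Submodule.span ℝ (InversionDecomposition.basisSet w) =
        InversionDecomposition.rootSpace n) ∧
    ∃ α : Fin (n - 1) → (Fin n → ℝ),
      Function.Injective α ∧ Set.range α = InversionDecomposition.basisSet w ∧
      ∀ i j : Fin (n - 1), i < j → ∀ x : InversionDecomposition.Var n,
        InversionDecomposition.IsPivot w (α i) x → ¬ InversionDecomposition.IsFree w (α j) x := by
  obtain ⟨c, hc⟩ := hw.exists_isColoring
  obtain ⟨α, hinj, hrange, hα⟩ := hc.exists_enumeration hn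
  have hmem : ∀ i, α i ∈ basisSet w := fun i => hrange ▸ Set.mem_range_self i
  exact ⟨⟨hc.linearIndepOn_basisSet, hc.span_basisSet hn⟩, α, hinj, hrange,
    fun i j hij x hp hf =>
      (hα i j hij).not_gt (hc.blockRank_lt_of_isPivot_of_isFree (hmem i) (hmem j) hp hf)⟩
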